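/- A plane increasing binary tree of size $n\ge 1$ is a non-empty binary tree with $n$ nodes, in which left and right children are distinguished and each of them may be missing, whose nodes carry the labels $1,\dots,n$, each exactly once, such that the labels increase along every path that leads away from the root. A fringe subtree of a tree consists of a node together with all its descendants, and its shape is the unlabelled plane binary tree that is left when the labels are forgotten. Let $T(z)=\sum_{n\ge1}T_n\frac{z^n}{n!}$ be the exponential generating function of plane increasing binary trees. For an unlabelled plane binary tree $t$ with $|t|\ge 1$ nodes let $S_t(z)$ be the exponential generating function of those plane increasing binary trees in which no fringe subtree has shape $t$. Let $\mathcal{B}_{\le n}$ be the set of unlabelled plane binary trees $t$ with $1\le|t|\le n$. **Proposition.** As $n\to\infty$, $$\sum_{\substack{t\in\mathcal{B}_{\le n}\\ |t|\ge\log_4 n}}\left(1-\frac{[z^n]S_t(z)}{[z^n]T(z)}\right)=\Omega(\sqrt n).$$ Equivalently, if $\tau_n$ is a uniformly random plane increasing binary tree of size $n$, then $$\sum_{\substack{t\in\mathcal{B}_{\le n}\\ |t|\ge\log_4 n}}\mathbb{P}\left(t\text{ occurs as the shape of a fringe subtree of }\tau_n\right)=\Omega(\sqrt n).$$ Hence,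 if $X_n$ denotes the size of the compacted tree of $\tau_n$, that is, the number of distinct shapes of fringe subtrees of $\tau_n$, then $\mathbb{E}(X_n)=\Omega(\sqrt n)$. Here $f(n)=\Omega(\sqrt n)$ means that there are a constant $c>0$ and an $N$ such that $f(n)\ge c\sqrt n$ for all $n\ge N$. -/

import Mathlib

open Filter

namespace IncBinTree

/-- The multiset of the labels of a plane binary tree. -/
def labels {α : Type*} : BinaryTree α → Multiset α
  | .nil => 0
  | .node a l r => a ::ₘ (labels l + labels r)

/-- The label of every node is smaller than the labels of all its proper descendants, i.e. the
labels increase along every path that leads away from the root. -/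
def Increasing {α : Type*} [LT α] : BinaryTree α → Prop
  | .nil => True
  | .node a l r =>
      (∀ b ∈ labels l, a < b) ∧ (∀ b ∈ labels r, a < b) ∧ Increasing l ∧ Increasing r

/-- The plane increasing binary trees of size `n`: non-empty plane binary trees (left and right
children are distinguished, each may be missing) with `n` nodes that carry the labels `1, …, n`,
each of them once, increasingly. -/
def increasingTreeSet (n : ℕ) : Set (BinaryTree ℕ) :=
  {τ | τ ≠ .nil ∧ labels τ = (Finset.Icc 1 n).val ∧ Increasing τ}

theorem finite_of_labels (s : Finset ℕ) (m : ℕ) :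
    {τ : BinaryTree ℕ | τ.numNodes ≤ m ∧ ∀ a ∈ labels τ, a ∈ s}.Finite := by
  induction m with
  | zero =>
    refine (Set.finite_singleton BinaryTree.nil).subset ?_
    rintro (_ | ⟨a, l, r⟩) ⟨h, -⟩
    · rfl
    · simp at h
  | succ m ih =>
    refine ((Set.finite_singleton BinaryTree.nil).union
      (((s.finite_toSet.prod (ih.prod ih))).image
        fun p => BinaryTree.node p.1 p.2.1 p.2.2)).subset ?_
    rintro (_ | ⟨a, l, r⟩) ⟨h, hs⟩
    · exact Or.inl rfl
    · right
      simp only [BinaryTree.numNodes] at h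
      simp only [labels, Multiset.mem_cons, Multiset.mem_add] at hs
      have h₁ : l.numNodes ≤ m := by omega
      have h₂ : r.numNodes ≤ m := by omega
      exact ⟨(a, l, r), ⟨hs a (Or.inl rfl), ⟨h₁, fun b hb => hs b (Or.inr (Or.inl hb))⟩,
        ⟨h₂, fun b hb => hs b (Or.inr (Or.inr hb))⟩⟩, rfl⟩

theorem card_labels {α : Type*} (τ : BinaryTree α) : (labels τ).card = τ.numNodes := by
  induction τ with
  | nil => rfl
  | node a l r hl hr => simp [labels, hl, hr]

theorem finite_increasingTreeSet (n : ℕ) : (increasingTreeSet n).Finite := by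
  refine (finite_of_labels (Finset.Icc 1 n) n).subset ?_
  rintro τ ⟨-, h, -⟩
  refine ⟨?_, fun a ha => ?_⟩
  · rw [← card_labels, h]; simp
  · rw [h] at ha; exact ha

/-- The finite set of all plane increasing binary trees of size `n`. -/
noncomputable def increasingTrees (n : ℕ) : Finset (BinaryTree ℕ) :=
  (finite_increasingTreeSet n).toFinset

/-- The shape of a labelled tree: the labels are forgotten. -/
def shape {α : Type*} (τ : BinaryTree α) : BinaryTree Unit := τ.map fun _ => ()

/-- The fringe subtrees of a tree (a node together with all its descendants), one for each node. -/
def fringeSubtrees {α : Type*} : BinaryTree α → List (BinaryTree α)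
  | .nil => []
  | .node a l r => .node a l r :: (fringeSubtrees l ++ fringeSubtrees r)

/-- The set of the distinct shapes of the fringe subtrees. -/
def fringeShapes {α : Type*} (τ : BinaryTree α) : Finset (BinaryTree Unit) :=
  ((fringeSubtrees τ).map shape).toFinset

/-- The size of the compacted tree: only one occurrence of each fringe subtree shape is kept. -/
def compactedSize {α : Type*} (τ : BinaryTree α) : ℕ := (fringeShapes τ).card

/-- The unlabelled plane binary trees (tree shapes) of size at least `1` and at most `n`. -/
def shapesUpTo (n : ℕ) : Finset (BinaryTree Unit) :=
  (Finset.Icc 1 n).biUnion BinaryTree.treesOfNumNodesEq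

/-- The shapes `t` of size at most `n` with `|t| ≥ log₄ n`. -/
noncomputable def largeShapes (n : ℕ) : Finset (BinaryTree Unit) :=
  (shapesUpTo n).filter fun t => Real.logb 4 n ≤ (t.numNodes : ℝ)

/-- The exponential generating function `T(z)` of plane increasing binary trees. -/
noncomputable def egfT : PowerSeries ℝ :=
  PowerSeries.mk fun n => ((increasingTrees n).card : ℝ) / n.factorial

/-- The exponential generating function `S_t(z)` of the plane increasing binary trees that do not
contain the shape `t` as a fringe subtree. -/
noncomputable def egfS (t : BinaryTree Unit) : PowerSeries ℝ :=
  PowerSeries.mk fun n =>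
    (((increasingTrees n).filter fun τ => t ∉ fringeShapes τ).card : ℝ) / n.factorial

/-- The probability that the shape `t` occurs as the shape of a fringe subtree of a uniformly
random plane increasing binary tree of size `n`. -/
noncomputable def occurrenceProb (n : ℕ) (t : BinaryTree Unit) : ℝ :=
  (((increasingTrees n).filter fun τ => t ∈ fringeShapes τ).card : ℝ) / (increasingTrees n).card

/-- The expected size of the compacted tree of a uniformly random plane increasing binary tree of
size `n`. -/
noncomputable def expectedCompactedSize (n : ℕ) : ℝ :=
  (∑ τ ∈ increasingTrees n, (compactedSize τ : ℝ)) / (increasingTrees n).card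

end IncBinTree

namespace IncBinTree

open BinaryTree Finset

/-! ### Shapes and fringe subtrees -/

/-! A single size `k`, about `n ^ (1/4)`, already yields the bound. By the hook length formula
(`card_labellings`) a random increasing tree of size `k` has shape `t` with probability `shapeProb
t`, and the left subtree of the root has uniformly distributed size. The expected number of fringe
subtrees of size `k` in a tree of size `n > k` is therefore `2(n+1)/((k+1)(k+2))`, of order `√n` for
this `k`.

It remains to see that most of these subtrees have different shapes. A union bound
(`shapeOccurrenceProb_le`) and a second-order correction (`le_shapeOccurrenceProb`) show that `t`
occurs with probability at least `shapeProb t` times this mean, minus `O(shapeProb t ^ 2 * n ^ 2 / k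
^ 2)`. Summed over all `t` of size `k`, the loss is governed by the collision probability `∑
shapeProb t ^ 2`, which decays exponentially in `k` (`collisionProb_le`) and hence beats `1 / n`. At
least half of the lower bound `(n+1)/(k+1)^2` for the mean survives. -/

theorem shape_node {α : Type*} (a : α) (l r : BinaryTree α) :
    shape (.node a l r) = .node () (shape l) (shape r) := rfl

theorem shape_unit (u : BinaryTree Unit) : shape u = u := by
  induction u with
  | nil => rfl
  | node a l r hl hr => rw [shape_node, hl, hr]

theorem numNodes_shape {α : Type*} (τ : BinaryTree α) : (shape τ).numNodes = τ.numNodes := by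
  induction τ with
  | nil => rfl
  | node a l r hl hr => simp [shape_node, hl, hr]

theorem notMem_fringeShapes_nil {α : Type*} (t : BinaryTree Unit) :
    t ∉ fringeShapes (.nil : BinaryTree α) := by
  simp [fringeShapes, fringeSubtrees]

theorem mem_fringeShapes_node {α : Type*} {t : BinaryTree Unit} {a : α} {l r : BinaryTree α} :
    t ∈ fringeShapes (.node a l r) ↔
      t = shape (.node a l r) ∨ t ∈ fringeShapes l ∨ t ∈ fringeShapes r := by
  simp [fringeShapes, fringeSubtrees, eq_comm]

theorem fringeShapes_shape {α : Type*} (τ : BinaryTree α) :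
    fringeShapes (shape τ) = fringeShapes τ := by
  induction τ with
  | nil => rfl
  | node a l r hl hr =>
    ext t
    rw [shape_node, mem_fringeShapes_node, mem_fringeShapes_node, hl, hr, ← shape_node a l r,
      shape_unit]

theorem numNodes_le_of_mem_fringeShapes {α : Type*} {t : BinaryTree Unit} {τ : BinaryTree α}
    (h : t ∈ fringeShapes τ) : 1 ≤ t.numNodes ∧ t.numNodes ≤ τ.numNodes := by
  induction τ with
  | nil => exact absurd h (notMem_fringeShapes_nil t)
  | node a l r hl hr =>
    rcases mem_fringeShapes_node.1 h with rfl | h | h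
    · rw [numNodes_shape]; simp
    · have := hl h; simp only [numNodes]; omega
    · have := hr h; simp only [numNodes]; omega

theorem mem_shapesUpTo {n : ℕ} {t : BinaryTree Unit} :
    t ∈ shapesUpTo n ↔ 1 ≤ t.numNodes ∧ t.numNodes ≤ n := by
  simp [shapesUpTo, mem_treesOfNumNodesEq]

/-- A shape of the same size as `u` occurs in `u` only if it is `u`. -/
theorem mem_fringeShapes_iff_eq {t u : BinaryTree Unit} (h : t.numNodes = u.numNodes)
    (ht : 1 ≤ t.numNodes) : t ∈ fringeShapes u ↔ t = u := by
  cases u with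
  | nil => simp at h; omega
  | node a l r =>
    rw [mem_fringeShapes_node, shape_unit]
    refine ⟨?_, Or.inl⟩
    rintro (h' | h' | h')
    · exact h'
    · have := numNodes_le_of_mem_fringeShapes h'; simp only [numNodes] at h; omega
    · have := numNodes_le_of_mem_fringeShapes h'; simp only [numNodes] at h; omega

/-! ### Increasing labellings of a shape -/

/-- The increasing trees with label set `s` and shape `u`. -/
noncomputable def labellings : BinaryTree Unit → Finset ℕ → Finset (BinaryTree ℕ)
  | .nil, s => if s = ∅ then {.nil} else ∅
  | .node _ l r, s =>
      if h : s.Nonempty then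
        ((s.erase (s.min' h)).powersetCard l.numNodes).biUnion fun A =>
          (labellings l A ×ˢ labellings r (s.erase (s.min' h) \ A)).image fun p =>
            .node (s.min' h) p.1 p.2
      else ∅

theorem mem_labellings {u : BinaryTree Unit} {s : Finset ℕ} {τ : BinaryTree ℕ} :
    τ ∈ labellings u s ↔ labels τ = s.val ∧ Increasing τ ∧ shape τ = u := by
  induction u generalizing s τ with
  | nil =>
    rw [labellings]
    cases τ with
    | nil =>
      split_ifs with h
      · simp [h, labels, Increasing, shape, BinaryTree.map]
      · simp only [notMem_empty, labels, false_iff, not_and]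
        intro h'
        exact absurd (Finset.val_eq_zero.1 h'.symm) h
    | node a l r =>
      split_ifs <;> simp [shape_node]
  | node c l r hl hr =>
    rw [labellings]
    split_ifs with h
    · simp only [mem_biUnion, mem_powersetCard, mem_image, mem_product, hl, hr, Prod.exists]
      constructor
      · rintro ⟨A, ⟨hA, hc⟩, x, y, ⟨⟨hx, hxi, hxs⟩, hy, hyi, hys⟩, rfl⟩
        refine ⟨?_, ⟨?_, ?_, hxi, hyi⟩, ?_⟩
        · rw [labels, hx, hy, Finset.sdiff_val, add_tsub_cancel_of_le (Finset.val_le_iff.2 hA),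
            Finset.erase_val]
          exact Multiset.cons_erase (s.min'_mem h)
        · intro b hb
          rw [hx] at hb
          exact s.min'_lt_of_mem_erase_min' h (hA hb)
        · intro b hb
          rw [hy] at hb
          exact s.min'_lt_of_mem_erase_min' h (Finset.sdiff_subset hb)
        · rw [shape_node, hxs, hys]
      · rintro ⟨hlab, hinc, hsh⟩
        cases τ with
        | nil => simp [shape, BinaryTree.map] at hsh
        | node a x y =>
          simp only [shape_node, BinaryTree.node.injEq, true_and] at hsh
          obtain ⟨hax, hay, hxi, hyi⟩ := hinc
          rw [labels] at hlab
          have hmem : ∀ b, b ∈ s ↔ b = a ∨ b ∈ labels x ∨ b ∈ labels y := by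
            intro b
            rw [← Finset.mem_val, ← hlab]; simp
          -- An increasing tree carries its least label at the root, so only the label set of the
          -- left subtree is free.
          have ha : s.min' h = a := by
            refine le_antisymm (s.min'_le _ ((hmem a).2 (Or.inl rfl))) ?_
            rcases (hmem _).1 (s.min'_mem h) with h' | h' | h'
            · exact h'.ge
            · exact (hax _ h').le
            · exact (hay _ h').le
          have hval : (s.erase (s.min' h)).val = labels x + labels y := by
            rw [ha, Finset.erase_val, ← hlab, Multiset.erase_cons_head]
          have hnd : (labels x + labels y).Nodup := hval ▸ Finset.nodup _
          have hxnd : (labels x).Nodup := Multiset.nodup_of_le (Multiset.le_add_right _ _) hnd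
          refine ⟨⟨labels x, hxnd⟩, ⟨?_, ?_⟩, x, y, ⟨⟨rfl, hxi, hsh.1⟩, ?_, hyi, hsh.2⟩, by rw [ha]⟩
          · rw [← Finset.val_le_iff, hval]
            exact Multiset.le_add_right _ _
          · rw [Finset.card_mk, card_labels, ← hsh.1, numNodes_shape]
          · rw [Finset.sdiff_val, hval, add_tsub_cancel_left]
    · simp only [notMem_empty, false_iff]
      rintro ⟨hlab, -, hsh⟩
      rw [Finset.not_nonempty_iff_eq_empty.1 h] at hlab
      cases τ with
      | nil => simp [shape, BinaryTree.map] at hsh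
      | node a x y => simp [labels] at hlab

/-- The product of the reciprocals of the sizes of the fringe subtrees: the probability that a
random increasing tree of size `|u|` has shape `u`. -/
noncomputable def shapeProb : BinaryTree Unit → ℝ
  | .nil => 1
  | .node _ l r => shapeProb l * shapeProb r / ((l.numNodes + r.numNodes + 1 : ℕ) : ℝ)

theorem shapeProb_nonneg (u : BinaryTree Unit) : 0 ≤ shapeProb u := by
  induction u with
  | nil => simp [shapeProb]
  | node a l r hl hr => rw [shapeProb]; positivity

/-- Hook length formula: the root takes the minimum, and a binomial coefficient counts the ways to
split the remaining labels between the subtrees. It cancels their factorials up to the factor `1 /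
|u|`. -/
theorem card_labellings {u : BinaryTree Unit} {s : Finset ℕ} (h : s.card = u.numNodes) :
    ((labellings u s).card : ℝ) = u.numNodes.factorial * shapeProb u := by
  induction u generalizing s with
  | nil =>
    rw [numNodes, Finset.card_eq_zero] at h
    simp [labellings, h, shapeProb]
  | node c l r hl hr =>
    have hs : s.Nonempty := Finset.card_pos.1 (by rw [h, numNodes]; omega)
    have hcard : (s.erase (s.min' hs)).card = l.numNodes + r.numNodes := by
      rw [Finset.card_erase_of_mem (s.min'_mem hs), h, numNodes]; omega
    rw [labellings, dif_pos hs, Finset.card_biUnion, Nat.cast_sum]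
    · have key : ∀ A ∈ (s.erase (s.min' hs)).powersetCard l.numNodes,
          ((((labellings l A ×ˢ labellings r (s.erase (s.min' hs) \ A)).image fun p =>
            BinaryTree.node (s.min' hs) p.1 p.2).card : ℕ) : ℝ) =
          (l.numNodes.factorial * shapeProb l) * (r.numNodes.factorial * shapeProb r) := by
        intro A hA
        rw [mem_powersetCard] at hA
        rw [Finset.card_image_of_injective, Finset.card_product, Nat.cast_mul, hl hA.2, hr]
        · rw [Finset.card_sdiff_of_subset hA.1, hcard, hA.2]; omega
        · rintro ⟨x, y⟩ ⟨x', y'⟩ hxy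
          simpa using hxy
      rw [Finset.sum_congr rfl key, Finset.sum_const, Finset.card_powersetCard, hcard,
        nsmul_eq_mul, numNodes, shapeProb, Nat.factorial_succ,
        ← Nat.add_choose_mul_factorial_mul_factorial]
      push_cast
      rw [Nat.choose_symm_add]
      field_simp
    -- The tree determines `A` as the label multiset of its left subtree, so the union is disjoint.
    · intro A hA B hB hAB
      rw [Function.onFun, Finset.disjoint_left]
      intro τ h₁ h₂
      simp only [mem_image, mem_product, mem_labellings, Prod.exists] at h₁ h₂
      obtain ⟨x, y, ⟨⟨hx, -⟩, -⟩, rfl⟩ := h₁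
      obtain ⟨x', y', ⟨⟨hx', -⟩, -⟩, heq⟩ := h₂
      simp only [BinaryTree.node.injEq, true_and] at heq
      rw [heq.1, hx] at hx'
      exact hAB (Finset.val_injective hx')

theorem mem_increasingTrees {n : ℕ} {τ : BinaryTree ℕ} :
    τ ∈ increasingTrees n ↔ τ ≠ .nil ∧ labels τ = (Finset.Icc 1 n).val ∧ Increasing τ := by
  simp [increasingTrees, increasingTreeSet]

theorem numNodes_of_mem_increasingTrees {n : ℕ} {τ : BinaryTree ℕ} (h : τ ∈ increasingTrees n) :
    τ.numNodes = n := by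
  rw [← card_labels, (mem_increasingTrees.1 h).2.1]; simp

open Classical in
/-- Counting increasing trees by a property of the shape. -/
theorem card_filter_increasingTrees {n : ℕ} (hn : 1 ≤ n) (P : BinaryTree Unit → Prop) :
    (((increasingTrees n).filter fun τ => P (shape τ)).card : ℝ) =
      n.factorial * ∑ u ∈ treesOfNumNodesEq n, if P u then shapeProb u else 0 := by
  rw [Finset.card_eq_sum_card_fiberwise (f := shape) (t := treesOfNumNodesEq n), Nat.cast_sum,
    Finset.mul_sum]
  · refine Finset.sum_congr rfl fun u hu => ?_
    rw [mem_treesOfNumNodesEq] at hu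
    split_ifs with hP
    · rw [← hu, ← card_labellings (s := Finset.Icc 1 u.numNodes) (by simp)]
      congr 2
      ext τ
      simp only [mem_filter, mem_increasingTrees, mem_labellings]
      constructor
      · rintro ⟨⟨⟨-, h₁, h₂⟩, -⟩, h₃⟩
        exact ⟨h₁, h₂, h₃⟩
      · rintro ⟨h₁, h₂, h₃⟩
        refine ⟨⟨⟨?_, h₁, h₂⟩, h₃ ▸ hP⟩, h₃⟩
        rintro rfl
        rw [← h₃] at hu
        simp [shape, BinaryTree.map] at hu
        omega
    · rw [mul_zero, Nat.cast_eq_zero, Finset.card_eq_zero]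
      ext τ
      simp only [mem_filter, notMem_empty, iff_false]
      rintro ⟨⟨-, h₁⟩, h₂⟩
      exact hP (h₂ ▸ h₁)
  · intro τ hτ
    have := numNodes_of_mem_increasingTrees (Finset.mem_filter.1 hτ).1
    simp [numNodes_shape, this]

/-! ### Recursion at the root -/

theorem sum_treesOfNumNodesEq_succ (n : ℕ) (g : BinaryTree Unit → ℝ) :
    ∑ u ∈ treesOfNumNodesEq (n + 1), g u =
      ∑ p ∈ antidiagonal n, ∑ l ∈ treesOfNumNodesEq p.1, ∑ r ∈ treesOfNumNodesEq p.2,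
        g (.node () l r) := by
  rw [treesOfNumNodesEq_succ, Finset.sum_biUnion]
  · refine Finset.sum_congr rfl fun p _ => ?_
    rw [pairwiseNode, Finset.sum_map, Finset.sum_product]
    rfl
  · intro p hp q hq hpq
    rw [Function.onFun, Finset.disjoint_left]
    intro u h₁ h₂
    simp only [pairwiseNode, Finset.mem_map, mem_product, mem_treesOfNumNodesEq] at h₁ h₂
    obtain ⟨⟨x, y⟩, ⟨hx, hy⟩, rfl⟩ := h₁
    obtain ⟨⟨x', y'⟩, ⟨hx', hy'⟩, h⟩ := h₂
    simp at h
    refine hpq (Prod.ext ?_ ?_)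
    · rw [← hx, ← hx', h.1]
    · rw [← hy, ← hy', h.2]

/-- The recursion for sums over shapes of a size whose summand is a product at the root. -/
theorem sum_treesOfNumNodesEq_succ_mul (n : ℕ) {g a b : BinaryTree Unit → ℝ} {c : ℝ}
    (h : ∀ l r, l.numNodes + r.numNodes = n → g (.node () l r) = a l * b r / c) :
    ∑ u ∈ treesOfNumNodesEq (n + 1), g u =
      (∑ p ∈ antidiagonal n,
        (∑ l ∈ treesOfNumNodesEq p.1, a l) * ∑ r ∈ treesOfNumNodesEq p.2, b r) / c := by
  rw [sum_treesOfNumNodesEq_succ, Finset.sum_div]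
  refine Finset.sum_congr rfl fun p hp => ?_
  rw [Finset.sum_mul_sum, Finset.sum_div]
  refine Finset.sum_congr rfl fun l hl => ?_
  rw [Finset.sum_div]
  refine Finset.sum_congr rfl fun r hr => h l r ?_
  rw [mem_treesOfNumNodesEq] at hl hr
  rw [hl, hr, mem_antidiagonal.1 hp]

theorem shapeProb_node {n : ℕ} {l r : BinaryTree Unit} (h : l.numNodes + r.numNodes = n) :
    shapeProb (.node () l r) = shapeProb l * shapeProb r / (n + 1) := by
  rw [shapeProb, h]; push_cast; rfl

theorem sum_shapeProb (n : ℕ) : ∑ u ∈ treesOfNumNodesEq n, shapeProb u = 1 := by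
  induction n using Nat.strong_induction_on with
  | _ n ih =>
    cases n with
    | zero => simp [shapeProb]
    | succ n =>
      rw [sum_treesOfNumNodesEq_succ_mul n fun l r h => shapeProb_node h,
        Finset.sum_congr rfl (g := fun _ => (1 : ℝ))]
      · have : (n : ℝ) + 1 ≠ 0 := by positivity
        simp [this]
      · intro p hp
        have := mem_antidiagonal.1 hp
        rw [ih p.1 (by omega), ih p.2 (by omega), mul_one]

/-- The probability that two independent random shapes of size `n` agree. -/
noncomputable def collisionProb (n : ℕ) : ℝ := ∑ u ∈ treesOfNumNodesEq n, shapeProb u ^ 2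

theorem collisionProb_nonneg (n : ℕ) : 0 ≤ collisionProb n :=
  Finset.sum_nonneg fun _ _ => sq_nonneg _

theorem collisionProb_zero : collisionProb 0 = 1 := by simp [collisionProb, shapeProb]

theorem collisionProb_succ (n : ℕ) :
    collisionProb (n + 1) =
      (∑ p ∈ antidiagonal n, collisionProb p.1 * collisionProb p.2) / ((n : ℝ) + 1) ^ 2 :=
  sum_treesOfNumNodesEq_succ_mul n fun l r h => by
    rw [shapeProb_node h, div_pow, mul_pow]

/-- A bound `c * r ^ n` passes through the convolution recursion to size `N` as soon as `c ≤ N * r`.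
With `c = 9/5` and `r = 3/5` this means `N ≥ 3`, so sizes 0, 1 and 2 are checked by hand. -/
theorem collisionProb_le (n : ℕ) : collisionProb n ≤ 9 / 5 * (3 / 5) ^ n := by
  have h1 : collisionProb 1 = 1 := by
    rw [collisionProb_succ]; simp [collisionProb_zero]
  have h2 : collisionProb 2 = 1 / 2 := by
    rw [collisionProb_succ]
    simp [Finset.Nat.antidiagonal_succ, h1, collisionProb_zero]; norm_num
  induction n using Nat.strong_induction_on with
  | _ n ih =>
    rcases n with _ | _ | _ | n
    · rw [collisionProb_zero]; norm_num
    · rw [zero_add, h1]; norm_num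
    · rw [zero_add, h2]; norm_num
    · rw [collisionProb_succ, div_le_iff₀ (by positivity)]
      calc ∑ p ∈ antidiagonal (n + 2), collisionProb p.1 * collisionProb p.2
          ≤ ∑ p ∈ antidiagonal (n + 2), (9 / 5 : ℝ) ^ 2 * (3 / 5) ^ (n + 2) := by
            refine Finset.sum_le_sum fun p hp => ?_
            have hp := mem_antidiagonal.1 hp
            calc _ ≤ (9 / 5 * (3 / 5 : ℝ) ^ p.1) * (9 / 5 * (3 / 5 : ℝ) ^ p.2) :=
                  mul_le_mul (ih _ (by omega)) (ih _ (by omega)) (collisionProb_nonneg _)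
                    (by positivity)
              _ = _ := by rw [← hp, pow_add]; ring
        _ = ((n : ℝ) + 3) * ((9 / 5 : ℝ) ^ 2 * (3 / 5) ^ (n + 2)) := by
            rw [Finset.sum_const, Finset.Nat.card_antidiagonal, nsmul_eq_mul]; push_cast; ring
        _ ≤ _ := by
            have : (0 : ℝ) ≤ (3 / 5) ^ (n + 2) := by positivity
            rw [pow_succ (3 / 5 : ℝ) (n + 2)]
            push_cast
            have hn : (0 : ℝ) ≤ n := n.cast_nonneg
            have h3 : (0 : ℝ) ≤ (3 / 5) ^ (n + 2) * (n * (n + 3)) := by positivity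
            nlinarith

/-! ### The probability that a shape occurs -/

/-- The probability that `t` occurs in a random shape of size `n`. -/
noncomputable def shapeOccurrenceProb (t : BinaryTree Unit) (n : ℕ) : ℝ :=
  ∑ u ∈ treesOfNumNodesEq n, if t ∈ fringeShapes u then shapeProb u else 0

theorem shapeOccurrenceProb_nonneg (t : BinaryTree Unit) (n : ℕ) :
    0 ≤ shapeOccurrenceProb t n :=
  Finset.sum_nonneg fun u _ => by split_ifs <;> simp [shapeProb_nonneg]

theorem sum_shapeProb_notMem (t : BinaryTree Unit) (n : ℕ) :
    ∑ u ∈ treesOfNumNodesEq n, (if t ∈ fringeShapes u then 0 else shapeProb u) =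
      1 - shapeOccurrenceProb t n := by
  rw [← sum_shapeProb n, shapeOccurrenceProb, ← Finset.sum_sub_distrib]
  exact Finset.sum_congr rfl fun u _ => by split_ifs <;> simp

theorem shapeOccurrenceProb_of_lt {t : BinaryTree Unit} {n : ℕ} (h : n < t.numNodes) :
    shapeOccurrenceProb t n = 0 := by
  refine Finset.sum_eq_zero fun u hu => if_neg fun hm => ?_
  have := numNodes_le_of_mem_fringeShapes hm
  rw [mem_treesOfNumNodesEq] at hu
  omega

theorem shapeOccurrenceProb_self {t : BinaryTree Unit} (ht : 1 ≤ t.numNodes) :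
    shapeOccurrenceProb t t.numNodes = shapeProb t := by
  rw [shapeOccurrenceProb, Finset.sum_eq_single_of_mem t (mem_treesOfNumNodesEq_numNodes t),
    if_pos ((mem_fringeShapes_iff_eq rfl ht).2 rfl)]
  intro u hu hne
  rw [mem_treesOfNumNodesEq] at hu
  exact if_neg fun hm => hne ((mem_fringeShapes_iff_eq hu.symm ht).1 hm).symm

/-- The whole tree is too large to be `t`, so `t` is avoided exactly when both subtrees avoid it.
Avoidance is thus multiplicative at the root, and `1 - (1-x)(1-y) = x + y - xy`. -/
theorem shapeOccurrenceProb_succ {t : BinaryTree Unit} {n : ℕ} (h : t.numNodes ≤ n) :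
    ((n : ℝ) + 1) * shapeOccurrenceProb t (n + 1) =
      ∑ p ∈ antidiagonal n, (shapeOccurrenceProb t p.1 + shapeOccurrenceProb t p.2 -
        shapeOccurrenceProb t p.1 * shapeOccurrenceProb t p.2) := by
  have hrec := sum_treesOfNumNodesEq_succ_mul n (c := (n : ℝ) + 1)
    (g := fun u => if t ∈ fringeShapes u then 0 else shapeProb u)
    (a := fun u => if t ∈ fringeShapes u then 0 else shapeProb u)
    (b := fun u => if t ∈ fringeShapes u then 0 else shapeProb u) fun l r hlr => by
      have hne : t ≠ .node () l r := by
        rintro rfl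
        rw [numNodes] at h
        omega
      simp only [mem_fringeShapes_node, shape_unit, hne, false_or]
      rw [shapeProb_node hlr]
      by_cases h₁ : t ∈ fringeShapes l <;> by_cases h₂ : t ∈ fringeShapes r <;> simp [h₁, h₂]
  simp only [sum_shapeProb_notMem] at hrec
  have hn : (n : ℝ) + 1 ≠ 0 := by positivity
  rw [eq_div_iff hn] at hrec
  have h₁ : ∑ p ∈ antidiagonal n, (1 : ℝ) = n + 1 := by simp
  calc ((n : ℝ) + 1) * shapeOccurrenceProb t (n + 1)
      = (n + 1) - (1 - shapeOccurrenceProb t (n + 1)) * (n + 1) := by ring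
    _ = _ := by
      rw [hrec, ← h₁, ← Finset.sum_sub_distrib]
      exact Finset.sum_congr rfl fun p _ => by ring

/-- The expected number of fringe subtrees of size `k` in a random shape of size `n`. -/
noncomputable def meanFringe (k n : ℕ) : ℝ :=
  if n < k then 0 else if n = k then 1 else 2 * (n + 1) / ((k + 1) * (k + 2))

theorem meanFringe_nonneg (k n : ℕ) : 0 ≤ meanFringe k n := by
  rw [meanFringe]; split_ifs <;> positivity

theorem meanFringe_le (k n : ℕ) : meanFringe k n ≤ (n + 1) / (k + 1) := by
  rw [meanFringe]
  split_ifs with h₁ h₂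
  · positivity
  · rw [h₂, div_self (by positivity)]
  · rw [div_le_div_iff₀ (by positivity) (by positivity)]
    have : (0 : ℝ) ≤ (n + 1) * (k + 1) * k := by positivity
    linarith

/-- This is the linear part of the recursion for occurrence probabilities, with the product term
dropped. -/
theorem two_mul_sum_meanFringe {k n : ℕ} (h : k ≤ n) :
    2 * ∑ i ∈ range (n + 1), meanFringe k i = (n + 1) * meanFringe k (n + 1) := by
  induction n, h using Nat.le_induction with
  | base =>
    rw [Finset.sum_range_succ, Finset.sum_eq_zero]
    · simp only [meanFringe, lt_irrefl, if_false, if_true, not_lt.2 k.le_succ, k.succ_ne_self]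
      push_cast
      field_simp
      ring
    · intro i hi
      rw [meanFringe, if_pos (Finset.mem_range.1 hi)]
  | succ n hn ih =>
    rw [Finset.sum_range_succ, mul_add, ih]
    rw [meanFringe, meanFringe, if_neg (by omega), if_neg (by omega), if_neg (by omega),
      if_neg (by omega)]
    push_cast
    field_simp
    ring

theorem sum_antidiagonal_fst (n : ℕ) (g : ℕ → ℝ) :
    ∑ p ∈ antidiagonal n, g p.1 = ∑ i ∈ range (n + 1), g i :=
  Finset.Nat.sum_antidiagonal_eq_sum_range_succ_mk (fun p : ℕ × ℕ => g p.1) n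

theorem sum_antidiagonal_fst_add_snd (n : ℕ) (g : ℕ → ℝ) :
    ∑ p ∈ antidiagonal n, (g p.1 + g p.2) = 2 * ∑ i ∈ range (n + 1), g i := by
  rw [Finset.sum_add_distrib, sum_antidiagonal_fst,
    ← Finset.Nat.sum_antidiagonal_swap (f := fun p => g p.2)]
  simp only [Prod.snd_swap]
  rw [sum_antidiagonal_fst, two_mul]

theorem shapeOccurrenceProb_le {t : BinaryTree Unit} (ht : 1 ≤ t.numNodes) (n : ℕ) :
    shapeOccurrenceProb t n ≤ shapeProb t * meanFringe t.numNodes n := by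
  induction n using Nat.strong_induction_on with
  | _ n ih =>
    rcases lt_trichotomy n t.numNodes with h | rfl | h
    · rw [shapeOccurrenceProb_of_lt h]
      exact mul_nonneg (shapeProb_nonneg t) (meanFringe_nonneg _ _)
    · rw [shapeOccurrenceProb_self ht]
      simp [meanFringe]
    · obtain ⟨n, rfl⟩ : ∃ m, n = m + 1 := ⟨n - 1, by omega⟩
      have h : t.numNodes ≤ n := by omega
      refine le_of_mul_le_mul_left ?_ (show (0 : ℝ) < n + 1 by positivity)
      rw [shapeOccurrenceProb_succ h, mul_left_comm, ← two_mul_sum_meanFringe h,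
        ← sum_antidiagonal_fst_add_snd, Finset.mul_sum]
      refine Finset.sum_le_sum fun p hp => ?_
      have hp := mem_antidiagonal.1 hp
      have h₁ := ih p.1 (by omega)
      have h₂ := ih p.2 (by omega)
      have h₃ := mul_nonneg (shapeOccurrenceProb_nonneg t p.1) (shapeOccurrenceProb_nonneg t p.2)
      linarith

theorem sum_range_succ_mul_succ (n : ℕ) :
    ∑ i ∈ range (n + 1), ((i : ℝ) + 1) * (i + 2) = (n + 1) * (n + 2) * (n + 3) / 3 := by
  induction n with
  | zero => norm_num
  | succ n ih => rw [Finset.sum_range_succ, ih]; push_cast; ring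

theorem sum_antidiagonal_succ_mul_succ (n : ℕ) :
    ∑ p ∈ antidiagonal n, ((p.1 : ℝ) + 1) * (p.2 + 1) = (n + 1) * (n + 2) * (n + 3) / 6 := by
  -- Since `p.1 + p.2 = n`, polarization turns the product into a sum of functions of one coordinate
  -- each.
  have h : ∀ p ∈ antidiagonal n, ((p.1 : ℝ) + 1) * (p.2 + 1) =
      (n + 3) / 2 * ((p.1 + 1) + (p.2 + 1)) -
        ((p.1 + 1) * (p.1 + 2) + (p.2 + 1) * (p.2 + 2)) / 2 := by
    intro p hp
    rw [← mem_antidiagonal.1 hp]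
    push_cast
    ring
  have hlin : ∑ i ∈ range (n + 1), ((i : ℝ) + 1) = (n + 1) * (n + 2) / 2 := by
    clear h
    induction n with
    | zero => norm_num
    | succ n ih => rw [Finset.sum_range_succ, ih]; push_cast; ring
  rw [Finset.sum_congr rfl h, Finset.sum_sub_distrib, ← Finset.mul_sum, ← Finset.sum_div,
    sum_antidiagonal_fst_add_snd n fun i => (i : ℝ) + 1,
    sum_antidiagonal_fst_add_snd n fun i => ((i : ℝ) + 1) * (i + 2), hlin,
    sum_range_succ_mul_succ]
  ring

/-- The product term in the recursion is estimated by the union bound, and the resulting losses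
accumulate. The error term solves the recursion for these losses exactly: `1/3` from the errors
inherited from the two subtrees plus `1/6` from the new product terms gives its factor `1/2`. -/
theorem le_shapeOccurrenceProb {t : BinaryTree Unit} (ht : 1 ≤ t.numNodes) (n : ℕ) :
    shapeProb t * meanFringe t.numNodes n -
      shapeProb t ^ 2 * (((n : ℝ) + 1) * (n + 2) / (2 * (t.numNodes + 1) ^ 2)) ≤
        shapeOccurrenceProb t n := by
  induction n using Nat.strong_induction_on with
  | _ n ih =>
    have hpos : 0 ≤ shapeProb t ^ 2 * (((n : ℝ) + 1) * (n + 2) / (2 * (t.numNodes + 1) ^ 2)) := by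
      positivity
    rcases lt_trichotomy n t.numNodes with h | rfl | h
    · rw [shapeOccurrenceProb_of_lt h, meanFringe, if_pos h]
      linarith
    · rw [shapeOccurrenceProb_self ht]
      simp only [meanFringe, lt_irrefl, if_false, if_true]
      linarith
    · clear hpos
      obtain ⟨n, rfl⟩ : ∃ m, n = m + 1 := ⟨n - 1, by omega⟩
      have h : t.numNodes ≤ n := by omega
      set k := t.numNodes with hk
      set x := shapeProb t with hx
      have hx0 : 0 ≤ x := shapeProb_nonneg t
      refine le_of_mul_le_mul_left ?_ (show (0 : ℝ) < n + 1 by positivity)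
      rw [shapeOccurrenceProb_succ (hk ▸ h)]
      calc ((n : ℝ) + 1) * (x * meanFringe k (n + 1) -
            x ^ 2 * ((((n + 1 : ℕ) : ℝ) + 1) * ((n + 1 : ℕ) + 2) / (2 * (k + 1) ^ 2)))
          = x * ∑ p ∈ antidiagonal n, (meanFringe k p.1 + meanFringe k p.2) -
            x ^ 2 / (2 * (k + 1) ^ 2) * ∑ p ∈ antidiagonal n,
              (((p.1 : ℝ) + 1) * (p.1 + 2) + (p.2 + 1) * (p.2 + 2)) -
            x ^ 2 / (k + 1) ^ 2 * ∑ p ∈ antidiagonal n, ((p.1 : ℝ) + 1) * (p.2 + 1) := by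
            rw [sum_antidiagonal_fst_add_snd n fun i => ((i : ℝ) + 1) * (i + 2),
              sum_antidiagonal_fst_add_snd, sum_range_succ_mul_succ,
              sum_antidiagonal_succ_mul_succ, two_mul_sum_meanFringe h]
            push_cast
            field_simp
            ring
        _ ≤ _ := by
            rw [Finset.mul_sum, Finset.mul_sum, Finset.mul_sum, ← Finset.sum_sub_distrib,
              ← Finset.sum_sub_distrib]
            refine Finset.sum_le_sum fun p hp => ?_
            have hp := mem_antidiagonal.1 hp
            have h₁ := ih p.1 (by omega)
            have h₂ := ih p.2 (by omega)
            have h₃ : shapeOccurrenceProb t p.1 * shapeOccurrenceProb t p.2 ≤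
                (x * ((p.1 + 1) / (k + 1))) * (x * ((p.2 + 1) / (k + 1))) := by
              refine mul_le_mul ?_ ?_ (shapeOccurrenceProb_nonneg _ _) (by positivity)
              · exact (shapeOccurrenceProb_le ht _).trans
                  (mul_le_mul_of_nonneg_left (meanFringe_le _ _) hx0)
              · exact (shapeOccurrenceProb_le ht _).trans
                  (mul_le_mul_of_nonneg_left (meanFringe_le _ _) hx0)
            have e : (x * ((p.1 + 1) / (k + 1))) * (x * ((p.2 + 1) / (k + 1))) =
                x ^ 2 / (k + 1) ^ 2 * (((p.1 : ℝ) + 1) * (p.2 + 1)) := by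
              field_simp
            have e₂ : x ^ 2 / (2 * (k + 1) ^ 2) *
                  (((p.1 : ℝ) + 1) * (p.1 + 2) + (p.2 + 1) * (p.2 + 2)) =
                x ^ 2 * (((p.1 : ℝ) + 1) * (p.1 + 2) / (2 * (k + 1) ^ 2)) +
                x ^ 2 * (((p.2 : ℝ) + 1) * (p.2 + 2) / (2 * (k + 1) ^ 2)) := by
              ring
            rw [e₂]
            linarith

/-! ### The lower bound -/

/-- Summing over `t` turns `shapeProb t` into 1 and its square into the collision probability; `hq`
keeps the loss to half of the bound `hm`. -/
theorem le_sum_shapeOccurrenceProb {k n : ℕ} (hk : 1 ≤ k) (hkn : k < n)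
    (hq : collisionProb k * (n + 2) ≤ 1) :
    ((n : ℝ) + 1) / (2 * (k + 1) ^ 2) ≤ ∑ t ∈ treesOfNumNodesEq k, shapeOccurrenceProb t n := by
  have hm : ((n : ℝ) + 1) / (k + 1) ^ 2 ≤ meanFringe k n := by
    rw [meanFringe, if_neg (by omega), if_neg (by omega),
      div_le_div_iff₀ (by positivity) (by positivity)]
    have : (0 : ℝ) ≤ (n + 1) * (k + 1) * k := by positivity
    linarith
  calc ((n : ℝ) + 1) / (2 * (k + 1) ^ 2)
      = (n + 1) / (k + 1) ^ 2 - 1 * ((n + 1) / (2 * (k + 1) ^ 2)) := by field_simp; ring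
    _ ≤ meanFringe k n - collisionProb k * (n + 2) * ((n + 1) / (2 * (k + 1) ^ 2)) := by gcongr
    _ = (∑ t ∈ treesOfNumNodesEq k, shapeProb t) * meanFringe k n -
          collisionProb k * (((n : ℝ) + 1) * (n + 2) / (2 * (k + 1) ^ 2)) := by
        rw [sum_shapeProb]; ring
    _ = ∑ t ∈ treesOfNumNodesEq k, (shapeProb t * meanFringe k n -
          shapeProb t ^ 2 * (((n : ℝ) + 1) * (n + 2) / (2 * (k + 1) ^ 2))) := by
        rw [Finset.sum_sub_distrib, Finset.sum_mul, collisionProb, Finset.sum_mul]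
    _ ≤ _ := Finset.sum_le_sum fun t ht => by
        obtain rfl := mem_treesOfNumNodesEq.1 ht
        exact le_shapeOccurrenceProb hk n

theorem card_increasingTrees {n : ℕ} (hn : 1 ≤ n) :
    ((increasingTrees n).card : ℝ) = n.factorial := by
  have := card_filter_increasingTrees hn fun _ => True
  simpa [sum_shapeProb] using this

theorem occurrenceProb_eq {n : ℕ} (hn : 1 ≤ n) (t : BinaryTree Unit) :
    occurrenceProb n t = shapeOccurrenceProb t n := by
  have h := card_filter_increasingTrees hn fun u => t ∈ fringeShapes u
  simp only [fringeShapes_shape] at h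
  have hf : (n.factorial : ℝ) ≠ 0 := by positivity
  rw [occurrenceProb, card_increasingTrees hn, div_eq_iff hf, mul_comm, shapeOccurrenceProb]
  convert h

theorem occurrenceProb_nonneg (n : ℕ) (t : BinaryTree Unit) : 0 ≤ occurrenceProb n t := by
  rw [occurrenceProb]; positivity

theorem one_sub_coeff_egfS_div_coeff_egfT {n : ℕ} (hn : 1 ≤ n) (t : BinaryTree Unit) :
    1 - PowerSeries.coeff n (egfS t) / PowerSeries.coeff n egfT = occurrenceProb n t := by
  have hf : (n.factorial : ℝ) ≠ 0 := by positivity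
  have hc : ((increasingTrees n).card : ℝ) ≠ 0 := by rwa [card_increasingTrees hn]
  have h : (((increasingTrees n).filter fun τ => t ∈ fringeShapes τ).card : ℝ) +
      ((increasingTrees n).filter fun τ => t ∉ fringeShapes τ).card =
        (increasingTrees n).card := by
    exact_mod_cast Finset.card_filter_add_card_filter_not fun τ => t ∈ fringeShapes τ
  rw [egfS, egfT, PowerSeries.coeff_mk, PowerSeries.coeff_mk, div_div_div_cancel_right₀ hf,
    occurrenceProb, eq_div_iff hc, sub_mul, div_mul_cancel₀ _ hc]
  linarith

/-- Linearity of expectation over the indicators of the shapes. -/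
theorem expectedCompactedSize_eq (n : ℕ) :
    expectedCompactedSize n = ∑ t ∈ shapesUpTo n, occurrenceProb n t := by
  simp only [expectedCompactedSize, occurrenceProb]
  rw [← Finset.sum_div]
  congr 1
  have h : ∀ τ ∈ increasingTrees n, (compactedSize τ : ℝ) =
      ∑ t ∈ shapesUpTo n, if t ∈ fringeShapes τ then 1 else 0 := by
    intro τ hτ
    rw [compactedSize, Finset.sum_boole]
    congr 2
    ext t
    rw [Finset.mem_filter, mem_shapesUpTo]
    refine ⟨fun h => ⟨?_, h⟩, And.right⟩
    rw [← numNodes_of_mem_increasingTrees hτ]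
    exact numNodes_le_of_mem_fringeShapes h
  rw [Finset.sum_congr rfl h, Finset.sum_comm]
  exact Finset.sum_congr rfl fun t _ => Finset.sum_boole _ _

theorem eventually_collisionProb_le :
    ∀ᶠ k : ℕ in atTop, 18 / 5 * ((k : ℝ) + 1) ^ 4 * (3 / 5) ^ k ≤ 1 := by
  have h := (tendsto_pow_const_mul_const_pow_of_abs_lt_one 4
    (show |(3 / 5 : ℝ)| < 1 by rw [abs_lt]; norm_num)).comp (tendsto_add_atTop_nat 1)
  -- The limit is taken with exponent `k + 1`, and `18/5 * 5/3 = 6`.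
  filter_upwards [h.eventually (gt_mem_nhds (show (0 : ℝ) < 1 / 6 by norm_num))] with k hk
  simp only [Function.comp_apply, pow_succ (3 / 5 : ℝ) k] at hk
  push_cast at hk
  linarith

theorem sqrt_le_sum_occurrenceProb :
    ∀ᶠ n : ℕ in atTop, 1 / 8 * √(n : ℝ) ≤ ∑ t ∈ largeShapes n, occurrenceProb n t := by
  have hsqrt : Tendsto Nat.sqrt atTop atTop :=
    tendsto_atTop_atTop.2 fun b => ⟨b * b, fun a ha => Nat.le_sqrt.2 ha⟩
  filter_upwards [(hsqrt.comp hsqrt).eventually eventually_collisionProb_le,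
    (hsqrt.comp hsqrt).eventually (eventually_ge_atTop 2)] with n hexp hk
  simp only [Function.comp_apply] at hexp hk
  set m := Nat.sqrt n with hm
  -- Iterating the integer square root gives `k = ⌊n ^ (1/4)⌋`.
  set k := Nat.sqrt m with hk'
  have hkm : k * k ≤ m := Nat.sqrt_le m
  have hmn : m * m ≤ n := Nat.sqrt_le n
  have hkn : k < n := by
    have h₁ : k < k * k := by nlinarith
    have h₂ : m ≤ m * m := Nat.le_mul_self m
    omega
  have hlt : n + 1 ≤ (k + 1) ^ 4 := by
    have h₁ : m + 1 ≤ (k + 1) * (k + 1) := Nat.lt_succ_sqrt m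
    have h₂ : n + 1 ≤ (m + 1) * (m + 1) := Nat.lt_succ_sqrt n
    calc n + 1 ≤ _ := h₂
      _ ≤ ((k + 1) * (k + 1)) * ((k + 1) * (k + 1)) := Nat.mul_le_mul h₁ h₁
      _ = _ := by ring
  have hltR : (n : ℝ) + 1 ≤ ((k : ℝ) + 1) ^ 4 := by exact_mod_cast hlt
  -- The size threshold comes from `hexp` as well: `n ≤ (k+1)^4 ≤ (5/3)^k ≤ 4^k`.
  have hlarge : treesOfNumNodesEq k ⊆ largeShapes n := by
    intro t ht
    rw [mem_treesOfNumNodesEq] at ht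
    rw [largeShapes, Finset.mem_filter, mem_shapesUpTo, ht]
    refine ⟨⟨by omega, hkn.le⟩, ?_⟩
    rw [Real.logb_le_iff_le_rpow (by norm_num) (by exact_mod_cast (by omega : 0 < n)),
      Real.rpow_natCast]
    have h₁ : (5 / 3 : ℝ) ^ k ≤ 4 ^ k := by gcongr; norm_num
    have h₂ : (3 / 5 : ℝ) ^ k * (5 / 3) ^ k = 1 := by rw [← mul_pow]; norm_num
    have h₃ : ((k : ℝ) + 1) ^ 4 = ((k : ℝ) + 1) ^ 4 * (3 / 5) ^ k * (5 / 3) ^ k := by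
      rw [mul_assoc, h₂, mul_one]
    have h₄ : ((k : ℝ) + 1) ^ 4 * (3 / 5) ^ k * (5 / 3) ^ k ≤ 1 * (5 / 3) ^ k := by
      gcongr
      have : (0 : ℝ) ≤ ((k : ℝ) + 1) ^ 4 * (3 / 5) ^ k := by positivity
      linarith
    linarith
  have hq : collisionProb k * (n + 2) ≤ 1 := by
    -- Here `n + 2 ≤ 2(n + 1) ≤ 2(k+1)^4`, whence the constant `18/5` in `hexp`.
    calc collisionProb k * (n + 2) ≤ (9 / 5 * (3 / 5) ^ k) * (2 * ((k : ℝ) + 1) ^ 4) := by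
          have : (1 : ℝ) ≤ n + 1 := by simp
          exact mul_le_mul (collisionProb_le k) (by linarith) (by positivity) (by positivity)
      _ = 18 / 5 * ((k : ℝ) + 1) ^ 4 * (3 / 5) ^ k := by ring
      _ ≤ 1 := hexp
  calc 1 / 8 * √(n : ℝ) ≤ ((n : ℝ) + 1) / (2 * (k + 1) ^ 2) := by
        have hs : (√(n : ℝ)) ^ 2 = n := Real.sq_sqrt n.cast_nonneg
        have hs0 : 0 ≤ √(n : ℝ) := Real.sqrt_nonneg _
        have hk2 : ((k : ℝ)) ^ 2 ≤ √(n : ℝ) := by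
          apply Real.le_sqrt_of_sq_le
          have : (k * k) * (k * k) ≤ n := (Nat.mul_le_mul hkm hkm).trans hmn
          have : ((k : ℝ) * k) * (k * k) ≤ n := by exact_mod_cast this
          linarith
        have hk1 : (1 : ℝ) ≤ k := by exact_mod_cast (by omega : 1 ≤ k)
        -- From `k + 1 ≤ 2k` and `k ^ 2 ≤ √n`; the denominator is then at most `8√n`, which yields
        -- the constant `1/8`.
        have hk4 : ((k : ℝ) + 1) ^ 2 ≤ 4 * √(n : ℝ) := by nlinarith
        rw [le_div_iff₀ (by positivity)]
        nlinarith
    _ ≤ ∑ t ∈ treesOfNumNodesEq k, shapeOccurrenceProb t n :=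
        le_sum_shapeOccurrenceProb (by omega) hkn hq
    _ = ∑ t ∈ treesOfNumNodesEq k, occurrenceProb n t :=
        Finset.sum_congr rfl fun t _ => (occurrenceProb_eq (by omega) t).symm
    _ ≤ _ := Finset.sum_le_sum_of_subset_of_nonneg hlarge fun t _ _ => occurrenceProb_nonneg n t

end IncBinTree

theorem mainTheorem4 :
    (∃ c : ℝ, 0 < c ∧ ∀ᶠ n : ℕ in atTop,
      c * Real.sqrt (n : ℝ) ≤ ∑ t ∈ IncBinTree.largeShapes n,
        (1 - PowerSeries.coeff n (IncBinTree.egfS t) / PowerSeries.coeff n IncBinTree.egfT)) ∧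
    (∃ c : ℝ, 0 < c ∧ ∀ᶠ n : ℕ in atTop,
      c * Real.sqrt (n : ℝ) ≤ ∑ t ∈ IncBinTree.largeShapes n, IncBinTree.occurrenceProb n t) ∧
    (∃ c : ℝ, 0 < c ∧ ∀ᶠ n : ℕ in atTop,
      c * Real.sqrt (n : ℝ) ≤ IncBinTree.expectedCompactedSize n) := by
  refine ⟨⟨1 / 8, by norm_num, ?_⟩, ⟨1 / 8, by norm_num, IncBinTree.sqrt_le_sum_occurrenceProb⟩,
    ⟨1 / 8, by norm_num, ?_⟩⟩
  · filter_upwards [IncBinTree.sqrt_le_sum_occurrenceProb, eventually_ge_atTop 1] with n h hn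
    rwa [Finset.sum_congr rfl fun t _ => IncBinTree.one_sub_coeff_egfS_div_coeff_egfT hn t]
  · filter_upwards [IncBinTree.sqrt_le_sum_occurrenceProb] with n h
    rw [IncBinTree.expectedCompactedSize_eq]
    exact h.trans (Finset.sum_le_sum_of_subset_of_nonneg (Finset.filter_subset _ _)
      fun t _ _ => IncBinTree.occurrenceProb_nonneg n t)
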